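/- Let $d\ge 1$ and $0<a<b<\infty$, let $A_{a,b}=\{x\in\mathbb R^d: a\le \|x\|\le b\}$ (Euclidean norm, $r=\|x\|$), and let $L^2_{\mathrm{rad}}(A_{a,b})$ be the space of real-valued $f\in L^2(A_{a,b})$ (Lebesgue measure) such that $f(x)=h(\|x\|)$ for a.e. $x$, for some function $h$ of one real variable. For every $K$ let $E_K\subseteq\mathbb R^K$ be the set of exponent tuples that the learnable exponents of an RMN-Direct model with $K$ power terms can take. Let $\psi_{\log}(r;\mu)=(r^\mu-1)/\mu$ for $\mu\ne 0$ and $\psi_{\log}(r;0)=\log r$, and let $\mathcal H_K$ be the class of all RMN-Direct networks $$\phi(x)=\sum_{k=1}^K a_k r^{\mu_k}+c_0\,\psi_{\log}(r;\mu_{\log})+b_0,\qquad (\mu_1,\dots,\mu_K)\in E_K,\quad a_1,\dots,a_K,c_0,\mu_{\log},b_0\in\mathbb R .$$ Let $\mathcal H_K^0\subseteq\mathcal H_K$ be the subclass with $c_0=0$, i.e. of the functions $\sum_{k=1}^K a_k r^{\mu_k}+b_0$. Suppose that there is a sequence $\Lambda=(\mu_k)_{k\ge1}$ of distinct real numbers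 such that (i) (bilateral Müntz hypotheses) $\Lambda$ has infinitely many positive and infinitely many negative terms, and the subsequences $(\mu_k^+)$ of all its positive terms and $(\mu_k^-)$ of all its negative terms satisfy $\mu_k^+\to+\infty$, $\mu_k^-\to-\infty$, $\sum_k 1/\mu_k^+=\infty$ and $\sum_k 1/|\mu_k^-|=\infty$; (ii) (realizability in the large-$K$ limit) for every $n$ there are a $K$ and a tuple in $E_K$ among whose entries, in some order, $\mu_1,\dots,\mu_n$ all occur. Then every network in $\bigcup_K\mathcal H_K$ is square integrable on $A_{a,b}$, and both $\bigcup_K \mathcal H_K^0$ and the full class $\bigcup_K\mathcal H_K$ are dense in $L^2_{\mathrm{rad}}(A_{a,b})$. -/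

import Mathlib

open Filter MeasureTheory Topology

/-- The closed annulus `A_{a,b} = {x ∈ ℝ^d : a ≤ ‖x‖ ≤ b}` (Euclidean norm). -/
def annulus (d : ℕ) (a b : ℝ) : Set (EuclideanSpace ℝ (Fin d)) :=
  {x | a ≤ ‖x‖ ∧ ‖x‖ ≤ b}

/-- Lebesgue measure restricted to the annulus. -/
noncomputable def annulusMeasure (d : ℕ) (a b : ℝ) : Measure (EuclideanSpace ℝ (Fin d)) :=
  volume.restrict (annulus d a b)

/-- `L²_rad(A_{a,b})`: the subspace of real `L²(A_{a,b})` of those `f` for which there is a function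
`h` of one real variable with `f(x) = h(‖x‖)` for almost every `x` in the annulus. -/
def radialL2 (d : ℕ) (a b : ℝ) : Submodule ℝ (Lp ℝ 2 (annulusMeasure d a b)) where
  carrier := {f | ∃ h : ℝ → ℝ, f =ᵐ[annulusMeasure d a b] fun x => h ‖x‖}
  add_mem' := by
    rintro f g ⟨h₁, hf⟩ ⟨h₂, hg⟩
    refine ⟨fun r => h₁ r + h₂ r, ?_⟩
    filter_upwards [Lp.coeFn_add f g, hf, hg] with x hx h1 h2
    rw [hx, Pi.add_apply, h1, h2]
  zero_mem' := by
    refine ⟨fun _ => 0, ?_⟩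
    filter_upwards [Lp.coeFn_zero ℝ 2 (annulusMeasure d a b)] with x hx
    rw [hx, Pi.zero_apply]
  smul_mem' := by
    rintro c f ⟨h, hf⟩
    refine ⟨fun r => c * h r, ?_⟩
    filter_upwards [Lp.coeFn_smul c f, hf] with x hx h1
    rw [hx, Pi.smul_apply, h1, smul_eq_mul]

/-- The log-primitive `ψ_log(r; μ)`: `(r^μ - 1)/μ` for `μ ≠ 0` and `log r` for `μ = 0`. -/
noncomputable def logPrimitive (r μ : ℝ) : ℝ :=
  if μ = 0 then Real.log r else (r ^ μ - 1) / μ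

/-- The RMN-Direct network
`φ(x) = ∑ₖ aₖ r^{μₖ} + c₀ ψ_log(r; μ_log) + b₀`, with `r = ‖x‖`. -/
noncomputable def rmnDirect (d K : ℕ) (coef μ : Fin K → ℝ) (c₀ μlog b₀ : ℝ)
    (x : EuclideanSpace ℝ (Fin d)) : ℝ :=
  (∑ k, coef k * ‖x‖ ^ μ k) + c₀ * logPrimitive ‖x‖ μlog + b₀

/-- All RMN-Direct networks with `K` power terms, where the exponent tuple ranges over the set `E`
of tuples that the learnable exponents can take, and all other parameters are free. -/
def rmnDirectClass (d K : ℕ) (E : Set (Fin K → ℝ)) : Set (EuclideanSpace ℝ (Fin d) → ℝ) :=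
  {φ | ∃ μ ∈ E, ∃ (coef : Fin K → ℝ) (c₀ μlog b₀ : ℝ), φ = rmnDirect d K coef μ c₀ μlog b₀}

/-- The RMN-Direct networks `∑ₖ aₖ r^{μₖ} + b₀` with `K` power terms and no log term. -/
def rmnDirectPowerClass (d K : ℕ) (E : Set (Fin K → ℝ)) :
    Set (EuclideanSpace ℝ (Fin d) → ℝ) :=
  {φ | ∃ μ ∈ E, ∃ (coef : Fin K → ℝ) (b₀ : ℝ),
    φ = fun x => (∑ k, coef k * ‖x‖ ^ μ k) + b₀}

/-- The elements of `L²_rad(A_{a,b})` that are represented by a function in the class `H`. -/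
def inRadialL2 (d : ℕ) (a b : ℝ) (H : Set (EuclideanSpace ℝ (Fin d) → ℝ)) :
    Set (radialL2 d a b) :=
  {g | ∃ φ ∈ H, (g : Lp ℝ 2 (annulusMeasure d a b)) =ᵐ[annulusMeasure d a b] φ}

/-- The bilateral Müntz hypotheses on two sequences of exponents. -/
structure BilateralMuntz (μp μm : ℕ → ℝ) : Prop where
  pos : ∀ k, 0 < μp k
  neg : ∀ k, μm k < 0
  tendsto_pos : Tendsto μp atTop atTop
  tendsto_neg : Tendsto μm atTop atBot
  diverges_pos : Tendsto (fun n : ℕ => ∑ k ∈ Finset.range n, 1 / μp k) atTop atTop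
  diverges_neg : Tendsto (fun n : ℕ => ∑ k ∈ Finset.range n, 1 / |μm k|) atTop atTop

/-- A sequence `μ` of distinct reals whose subsequence of all positive terms and whose subsequence
of all negative terms satisfy the bilateral Müntz hypotheses. -/
def IsBilateralMuntzSequence (μ : ℕ → ℝ) : Prop :=
  Function.Injective μ ∧ ∃ p q : ℕ → ℕ, StrictMono p ∧ StrictMono q ∧
    Set.range p = {k | 0 < μ k} ∧ Set.range q = {k | μ k < 0} ∧ BilateralMuntz (μ ∘ p) (μ ∘ q)

/-- `E K` is the set of exponent `K`-tuples that a model with `K` power terms can take. The sequence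
`μ` is realized as `K` grows: each finite initial part of `μ` occurs, in some order, among the
entries of an exponent tuple that is available for some `K`. -/
def RealizesInLimit (E : (K : ℕ) → Set (Fin K → ℝ)) (μ : ℕ → ℝ) : Prop :=
  ∀ n : ℕ, ∃ K : ℕ, ∃ ν ∈ E K, ∀ k < n, ∃ j : Fin K, ν j = μ k

/-! Density is Müntz's theorem in the radius, and the positive exponents carry it. For exponents `l
k > q > 0`, an explicit integral recursion gives uniform error at most `∏ (1 - q / l k)` for `x ^ q`
on `(0, 1]`, and `∑ 1 / l k = ∞` drives this product to 0 (`rpowIcc_mem_closure_span`). So every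
monomial, hence by Weierstrass every continuous profile on `[a, b]`, is a uniform limit of
admissible sums (`exists_sum_rpow_near`). To pass to `L²`, restrict a radial function to almost any
ray to get a measurable profile, then approximate the profile by continuous ones in `L²` of the law
of `‖x‖`. Uniform approximation suffices from there, since the annulus has finite measure. -/

/-! ### Müntz's theorem on an interval of positive numbers -/

/-- For `v ≠ l`, the function `x^l ∫_x^1 t^(v - 1 - l) dt` is a combination of `x^l` and `x^v`. -/
theorem rpow_mul_integral_rpow {x l v : ℝ} (hx : 0 < x) (h : v ≠ l) :
    x ^ l * ∫ t in x..1, t ^ (v - 1 - l) = (x ^ l - x ^ v) / (v - l) := by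
  have hvl : v - l ≠ 0 := sub_ne_zero.2 h
  rw [integral_rpow (Or.inr ⟨fun h0 => hvl (by linarith), Set.notMem_uIcc_of_lt hx one_pos⟩),
    show v - 1 - l + 1 = v - l by ring, Real.one_rpow, Real.rpow_sub hx]
  have := (Real.rpow_pos_of_pos hx l).ne'
  field_simp

/-- Approximation of `x ^ q` on `(0, 1]` by the powers `x ^ l k`: if `Q` is the error for `n`
exponents, then `(l n - q) x^(l n) ∫_x^1 Q(t) t^(-1 - l n) dt` is an error for `n + 1` exponents. -/
theorem exists_abs_rpow_sub_sum_le_prod {q : ℝ} (hq : 0 ≤ q) {l : ℕ → ℝ}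
    (hinj : Function.Injective l) (hl : ∀ k, q < l k) (n : ℕ) :
    ∃ c : ℕ → ℝ, ∀ x : ℝ, 0 < x → x ≤ 1 →
      |x ^ q - ∑ k ∈ Finset.range n, c k * x ^ l k| ≤ ∏ k ∈ Finset.range n, (1 - q / l k) := by
  induction n with
  | zero =>
    refine ⟨0, fun x hx hx1 => ?_⟩
    simpa [abs_of_nonneg (Real.rpow_nonneg hx.le q)] using Real.rpow_le_one hx.le hx1 hq
  | succ n ih =>
    obtain ⟨c, hc⟩ := ih
    set s := l n
    have hqs : q < s := hl n
    have hs : 0 < s := hq.trans_lt hqs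
    set M := ∏ k ∈ Finset.range n, (1 - q / l k)
    let e : ℕ → ℝ := fun k => (s - q) * c k / (s - l k)
    -- Integrating the old error turns each `x ^ l k` into `e k * (x ^ l k - x ^ s)`; the new
    -- exponent `s` collects all the `x ^ s` terms.
    refine ⟨fun k => if k < n then e k else 1 - ∑ j ∈ Finset.range n, e j, fun x hx hx1 => ?_⟩
    have h0 : (0 : ℝ) ∉ Set.uIcc x 1 := Set.notMem_uIcc_of_lt hx one_pos
    have hint : ∀ v : ℝ, IntervalIntegrable (fun t : ℝ => t ^ v) volume x 1 := fun v =>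
      intervalIntegral.intervalIntegrable_rpow (Or.inr h0)
    have hsum : IntervalIntegrable
        (fun t : ℝ => ∑ k ∈ Finset.range n, c k * t ^ (l k - 1 - s)) volume x 1 := by
      simpa only [Finset.sum_fn] using IntervalIntegrable.sum (Finset.range n)
        fun k _ => (hint (l k - 1 - s)).const_mul (c k)
    have key : x ^ q - ∑ k ∈ Finset.range (n + 1),
          (if k < n then e k else 1 - ∑ j ∈ Finset.range n, e j) * x ^ l k
        = (s - q) * (x ^ s * ∫ t in x..1,
          (t ^ (q - 1 - s) - ∑ k ∈ Finset.range n, c k * t ^ (l k - 1 - s))) := by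
      rw [intervalIntegral.integral_sub (hint _)
          hsum,
        intervalIntegral.integral_finsetSum fun k _ => (hint _).const_mul _, mul_sub,
        rpow_mul_integral_rpow hx hqs.ne, Finset.mul_sum, mul_sub, Finset.mul_sum,
        Finset.sum_range_succ, if_neg (lt_irrefl n)]
      have h1 : ∑ k ∈ Finset.range n,
            (if k < n then e k else 1 - ∑ j ∈ Finset.range n, e j) * x ^ l k
          = ∑ k ∈ Finset.range n, e k * x ^ l k :=
        Finset.sum_congr rfl fun k hk => by rw [if_pos (Finset.mem_range.1 hk)]
      have h2 : ∑ k ∈ Finset.range n,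
            (s - q) * (x ^ s * ∫ t in x..1, c k * t ^ (l k - 1 - s))
          = ∑ k ∈ Finset.range n, (e k * x ^ l k - e k * x ^ s) := by
        refine Finset.sum_congr rfl fun k hk => ?_
        have hks : l k ≠ s := fun h => (Finset.mem_range.1 hk).ne (hinj h)
        have hks1 : l k - s ≠ 0 := sub_ne_zero.2 hks
        have hks2 : s - l k ≠ 0 := sub_ne_zero.2 hks.symm
        rw [intervalIntegral.integral_const_mul, mul_left_comm (x ^ s),
          rpow_mul_integral_rpow hx hks]
        simp only [e]
        field_simp
        ring
      rw [h1, h2, Finset.sum_sub_distrib, ← Finset.sum_mul]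
      have hqs1 : q - s ≠ 0 := sub_ne_zero.2 hqs.ne
      field_simp
      ring
    -- Writing `0 - 1 - s` lets `rpow_mul_integral_rpow` evaluate the bound with `v = 0`; the
    -- prefactor `s - q` then yields the factor `1 - q / s`.
    have hbound : |∫ t in x..1,
          (t ^ (q - 1 - s) - ∑ k ∈ Finset.range n, c k * t ^ (l k - 1 - s))|
        ≤ ∫ t in x..1, M * t ^ (0 - 1 - s) := by
      rw [← Real.norm_eq_abs]
      refine intervalIntegral.norm_integral_le_of_norm_le hx1 ?_ ((hint _).const_mul _)
      refine Eventually.of_forall fun t ht => ?_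
      have ht0 : 0 < t := hx.trans ht.1
      have hfac : ∀ v : ℝ, t ^ (v - 1 - s) = t ^ v * t ^ (0 - 1 - s) := fun v => by
        rw [← Real.rpow_add ht0]; ring_nf
      have : t ^ (q - 1 - s) - ∑ k ∈ Finset.range n, c k * t ^ (l k - 1 - s)
          = (t ^ q - ∑ k ∈ Finset.range n, c k * t ^ l k) * t ^ (0 - 1 - s) := by
        simp_rw [hfac q, hfac (l _), sub_mul, Finset.sum_mul, mul_assoc]
      rw [this, norm_mul, Real.norm_eq_abs, Real.norm_of_nonneg (Real.rpow_nonneg ht0.le _)]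
      exact mul_le_mul_of_nonneg_right (hc t ht0 ht.2) (Real.rpow_nonneg ht0.le _)
    have hM : 0 ≤ M := (abs_nonneg _).trans (hc x hx hx1)
    have hxs : 0 < x ^ s := Real.rpow_pos_of_pos hx s
    rw [key, Finset.prod_range_succ, abs_mul, abs_mul, abs_of_pos (sub_pos.2 hqs), abs_of_pos hxs]
    calc (s - q) * (x ^ s * |_|)
        ≤ (s - q) * (x ^ s * ∫ t in x..1, M * t ^ (0 - 1 - s)) := by
          have := sub_pos.2 hqs
          gcongr
      _ = (M * (1 - q / s)) * (1 - x ^ s) := by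
          rw [intervalIntegral.integral_const_mul, mul_left_comm (x ^ s),
            rpow_mul_integral_rpow hx hs.ne, Real.rpow_zero, zero_sub]
          field_simp
          ring
      _ ≤ M * (1 - q / s) := by
          refine mul_le_of_le_one_right (mul_nonneg hM ?_) (by linarith)
          rw [sub_nonneg, div_le_one hs]; exact hqs.le

/-- Since `1 - t ≤ exp (-t)`, the product is at most `exp (-q ∑ 1 / l k)`. -/
theorem tendsto_prod_one_sub_div_zero {q : ℝ} (hq : 0 < q) {l : ℕ → ℝ} (hl : ∀ k, q < l k)
    (hdiv : Tendsto (fun n : ℕ => ∑ k ∈ Finset.range n, 1 / l k) atTop atTop) :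
    Tendsto (fun n : ℕ => ∏ k ∈ Finset.range n, (1 - q / l k)) atTop (𝓝 0) := by
  have hnn : ∀ k, 0 ≤ 1 - q / l k := fun k => by
    rw [sub_nonneg, div_le_one (hq.trans (hl k))]; exact (hl k).le
  refine squeeze_zero (fun n => Finset.prod_nonneg fun k _ => hnn k) (fun n => ?_)
    (Real.tendsto_exp_neg_atTop_nhds_zero.comp (hdiv.const_mul_atTop hq))
  rw [Function.comp_apply, Finset.mul_sum, ← Finset.sum_neg_distrib, Real.exp_sum]
  refine Finset.prod_le_prod (fun k _ => hnn k) fun k _ => ?_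
  have := Real.add_one_le_exp (-(q * (1 / l k)))
  rw [mul_one_div] at this ⊢
  linarith

/-- The power function `r ↦ r ^ v` on a closed interval of positive numbers. -/
noncomputable def rpowIcc {a : ℝ} (b : ℝ) (ha : 0 < a) (v : ℝ) : C(Set.Icc a b, ℝ) where
  toFun r := (r : ℝ) ^ v
  continuous_toFun := continuous_subtype_val.rpow_const fun r =>
    Or.inl (ha.trans_le r.2.1).ne'

/-- Müntz's condition on exponents greater than `q` puts `r ^ q` into their closed span. -/
theorem rpowIcc_mem_closure_span {a b : ℝ} (ha : 0 < a) (hab : a ≤ b) {q : ℝ} (hq : 0 < q)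
    {l : ℕ → ℝ} (hinj : Function.Injective l) (hl : ∀ k, q < l k)
    (hdiv : Tendsto (fun n : ℕ => ∑ k ∈ Finset.range n, 1 / l k) atTop atTop) :
    rpowIcc b ha q ∈
      (Submodule.span ℝ (Set.range fun k => rpowIcc b ha (l k))).topologicalClosure := by
  have hb : 0 < b := ha.trans_le hab
  choose c hc using exists_abs_rpow_sub_sum_le_prod hq.le hinj hl
  -- The approximant on `(0, 1]`, rescaled by `r = b * x`.
  let u : ℕ → C(Set.Icc a b, ℝ) := fun n =>
    ∑ k ∈ Finset.range n, (b ^ q * c n k * (b ^ l k)⁻¹) • rpowIcc b ha (l k)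
  refine mem_closure_of_tendsto (f := u) (b := atTop) ?_ (Eventually.of_forall fun n =>
    Submodule.sum_mem _ fun k _ => Submodule.smul_mem _ _ (Submodule.subset_span ⟨k, rfl⟩))
  have hlim := (tendsto_prod_one_sub_div_zero hq hl hdiv).const_mul (b ^ q)
  rw [mul_zero] at hlim
  rw [tendsto_iff_dist_tendsto_zero]
  refine squeeze_zero (fun _ => dist_nonneg) (fun n => ?_) hlim
  have hbq : 0 ≤ b ^ q := Real.rpow_nonneg hb.le q
  have hpos : 0 < b / b ∧ b / b ≤ 1 := by rw [div_self hb.ne']; simp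
  have hprod := (abs_nonneg _).trans (hc n _ hpos.1 hpos.2)
  rw [dist_comm, ContinuousMap.dist_le (mul_nonneg hbq hprod)]
  intro r
  have hr : 0 < (r : ℝ) := ha.trans_le r.2.1
  have h1 := hc n ((r : ℝ) / b) (div_pos hr hb) ((div_le_one hb).2 r.2.2)
  have h2 : (rpowIcc b ha q) r - u n r = b ^ q * (((r : ℝ) / b) ^ q
      - ∑ k ∈ Finset.range n, c n k * ((r : ℝ) / b) ^ l k) := by
    simp only [u, ContinuousMap.sum_apply, ContinuousMap.smul_apply, smul_eq_mul, rpowIcc,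
      ContinuousMap.coe_mk, mul_sub, Finset.mul_sum]
    congr 1
    · rw [Real.div_rpow hr.le hb.le, mul_div_cancel₀ _ (Real.rpow_pos_of_pos hb q).ne']
    · refine Finset.sum_congr rfl fun k _ => ?_
      rw [Real.div_rpow hr.le hb.le]
      ring
  rw [Real.dist_eq, h2, abs_mul, abs_of_nonneg hbq]
  exact mul_le_mul_of_nonneg_left h1 hbq

/-- Müntz's theorem on `[a, b]`, with constants and one divergent subsequence of exponents. -/
theorem exists_sum_rpow_near {a b : ℝ} (ha : 0 < a) (hab : a ≤ b) {m : ℕ → ℝ}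
    (hinj : Function.Injective m) {p : ℕ → ℕ} (hp : Function.Injective p)
    (htop : Tendsto (m ∘ p) atTop atTop)
    (hdiv : Tendsto (fun n : ℕ => ∑ k ∈ Finset.range n, 1 / (m ∘ p) k) atTop atTop)
    (g : C(Set.Icc a b, ℝ)) {ε : ℝ} (hε : 0 < ε) :
    ∃ (N : ℕ) (c : ℕ → ℝ) (b₀ : ℝ), ∀ r : Set.Icc a b,
      |g r - ((∑ k ∈ Finset.range N, c k * (r : ℝ) ^ m k) + b₀)| < ε := by
  let S := Submodule.span ℝ
    (insert (1 : C(Set.Icc a b, ℝ)) (Set.range fun k => rpowIcc b ha (m k)))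
  have hmono : ∀ n : ℕ, rpowIcc b ha n ∈ S.topologicalClosure := by
    intro n
    rcases n.eq_zero_or_pos with rfl | hn
    · refine S.le_topologicalClosure (Submodule.subset_span (Or.inl ?_))
      ext r
      simp [rpowIcc]
    · obtain ⟨N, hN⟩ := eventually_atTop.1 (htop.eventually_gt_atTop (n : ℝ))
      have hdivN : Tendsto (fun j : ℕ => ∑ k ∈ Finset.range j, 1 / m (p (N + k))) atTop atTop := by
        have h1 := tendsto_atTop_add_const_right atTop
          (-∑ k ∈ Finset.range N, 1 / (m ∘ p) k) (hdiv.comp (tendsto_add_atTop_nat N))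
        refine h1.congr fun j => ?_
        simp only [Function.comp_apply]
        rw [add_comm j N, Finset.sum_range_add]
        ring
      refine (Submodule.topologicalClosure_mono (Submodule.span_mono ?_))
        (rpowIcc_mem_closure_span ha hab (Nat.cast_pos.2 hn)
          (l := fun k => m (p (N + k))) (fun i j h => Nat.add_left_cancel (hp (hinj h)))
          (fun k => hN _ (Nat.le_add_right N k)) hdivN)
      rintro _ ⟨k, rfl⟩
      exact Or.inr ⟨p (N + k), rfl⟩
  have hpoly : ((polynomialFunctions (Set.Icc a b) : Subalgebra ℝ C(Set.Icc a b, ℝ)) :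
      Set C(Set.Icc a b, ℝ)) ⊆ S.topologicalClosure := by
    rw [polynomialFunctions_coe]
    rintro _ ⟨P, rfl⟩
    have : Polynomial.toContinuousMapOnAlgHom (Set.Icc a b) P
        = ∑ n ∈ P.support, P.coeff n • rpowIcc b ha n := by
      ext r
      simp [rpowIcc, Polynomial.eval_eq_sum, Polynomial.sum, ContinuousMap.sum_apply]
    rw [this]
    exact Submodule.sum_mem _ fun n _ => Submodule.smul_mem _ _ (hmono n)
  have hg : g ∈ closure (S : Set C(Set.Icc a b, ℝ)) := by
    have h1 := continuousMap_mem_polynomialFunctions_closure a b g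
    exact closure_minimal hpoly S.isClosed_topologicalClosure h1
  obtain ⟨v, hv, hgv⟩ := Metric.mem_closure_iff.1 hg ε hε
  obtain ⟨b₀, w, hw, rfl⟩ := Submodule.mem_span_insert.1 hv
  obtain ⟨c, rfl⟩ := Finsupp.mem_span_range_iff_exists_finsupp.1 hw
  refine ⟨c.support.sup id + 1, c, b₀, fun r => ?_⟩
  have hsub : c.support ⊆ Finset.range (c.support.sup id + 1) := fun k hk =>
    Finset.mem_range.2 (Nat.lt_succ_of_le (Finset.le_sup (f := id) hk))
  have h1 := (ContinuousMap.dist_apply_le_dist r).trans_lt hgv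
  rw [Finsupp.sum_of_support_subset c hsub (fun k t => t • rpowIcc b ha (m k))
    fun k _ => zero_smul ℝ _] at h1
  simpa [Real.dist_eq, rpowIcc, ContinuousMap.sum_apply, add_comm] using h1

/-! ### Measurable radial profiles -/

/-- A measurable function that agrees a.e. with some radial function agrees a.e. with the radial
function of a measurable profile. -/
theorem exists_measurable_radial_ae_eq {F : Type*} [NormedAddCommGroup F] [NormedSpace ℝ F]
    [FiniteDimensional ℝ F] [Nontrivial F] [MeasurableSpace F] [BorelSpace F] (ν : Measure F)
    [ν.IsAddHaarMeasure] {S : Set ℝ} (hS : MeasurableSet S) {g : F → ℝ} (hg : Measurable g)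
    {h : ℝ → ℝ} (hgh : ∀ᵐ x ∂ν.restrict ((‖·‖) ⁻¹' S), g x = h ‖x‖) :
    ∃ k : ℝ → ℝ, Measurable k ∧ ∀ᵐ x ∂ν.restrict ((‖·‖) ⁻¹' S), g x = k ‖x‖ := by
  have hA : MeasurableSet ((‖·‖) ⁻¹' S : Set F) := measurable_norm hS
  have hν : ν.restrict ({0}ᶜ : Set F) = ν :=
    Measure.restrict_eq_self_of_ae_mem (by simp [ae_iff])
  rw [ae_restrict_iff' hA] at hgh
  have hmp := Measure.measurePreserving_homeomorphUnitSphereProd ν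
  have hmp' := MeasurePreserving.symm (homeomorphUnitSphereProd F).toMeasurableEquiv hmp
  have h1 := hgh
  rw [← hν, ae_restrict_iff_subtype (measurableSet_singleton 0).compl] at h1
  have h2 := hmp'.quasiMeasurePreserving.ae h1
  have h3 := Measure.ae_ae_of_ae_prod h2
  have : NeBot (ae ν.toSphere) := ae_neBot.2 (Measure.toSphere_ne_zero ν)
  -- By Fubini in polar coordinates, almost every direction `s` satisfies `g (r • s) = h r` for
  -- almost every `r` in `S`; one exists because the sphere has positive measure.
  obtain ⟨s, hs⟩ := h3.exists
  refine ⟨fun r => g (r • (s : F)), hg.comp (measurable_id.smul_const _), ?_⟩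
  rw [ae_restrict_iff' hA]
  have h4 := hmp.quasiMeasurePreserving.ae (Measure.quasiMeasurePreserving_snd.ae hs)
  have h5 : ∀ᵐ x ∂ν, x ∈ ((‖·‖) ⁻¹' S : Set F) → g (‖x‖ • (s : F)) = h ‖x‖ := by
    rw [← hν, ae_restrict_iff_subtype (measurableSet_singleton 0).compl]
    filter_upwards [h4] with x hx hxS
    have hnorm : ‖(‖(x : F)‖ • (s : F))‖ = ‖(x : F)‖ := by simp [norm_smul]
    have hsymm : (((homeomorphUnitSphereProd F).toMeasurableEquiv.symm
        (s, ((homeomorphUnitSphereProd F) x).2) : ({0}ᶜ : Set F)) : F) = ‖(x : F)‖ • (s : F) := by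
      rw [Homeomorph.toMeasurableEquiv_symm_coe, homeomorphUnitSphereProd_symm_apply_coe,
        homeomorphUnitSphereProd_apply_snd_coe]
    rw [hsymm, Set.mem_preimage, hnorm] at hx
    exact hx hxS
  filter_upwards [hgh, h5] with x hx hx' hxS
  rw [hx hxS, hx' hxS]

/-! ### Square integrability on the annulus and density -/

theorem isCompact_annulus (d : ℕ) (a b : ℝ) : IsCompact (annulus d a b) := by
  refine (isCompact_closedBall (0 : EuclideanSpace ℝ (Fin d)) b).of_isClosed_subset
    (isClosed_Icc.preimage continuous_norm) fun x hx => ?_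
  simpa using hx.2

instance isFiniteMeasure_annulusMeasure (d : ℕ) (a b : ℝ) :
    IsFiniteMeasure (annulusMeasure d a b) :=
  isFiniteMeasure_restrict.2 (isCompact_annulus d a b).measure_lt_top.ne

theorem ae_mem_annulus (d : ℕ) (a b : ℝ) :
    ∀ᵐ x ∂annulusMeasure d a b, x ∈ annulus d a b :=
  ae_restrict_mem (isCompact_annulus d a b).isClosed.measurableSet

theorem memLp_radial {d : ℕ} {a b : ℝ} {k : ℝ → ℝ} (hk : ContinuousOn k (Set.Icc a b)) :
    MemLp (fun x => k ‖x‖) 2 (annulusMeasure d a b) := by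
  have hcont : ContinuousOn (fun x : EuclideanSpace ℝ (Fin d) => k ‖x‖) (annulus d a b) :=
    hk.comp continuous_norm.continuousOn fun x hx => hx
  obtain ⟨C, hC⟩ := (isCompact_annulus d a b).exists_bound_of_continuousOn hcont
  refine MemLp.of_bound
    (hcont.aestronglyMeasurable (isCompact_annulus d a b).isClosed.measurableSet) C ?_
  filter_upwards [ae_mem_annulus d a b] with x hx using hC x hx

theorem continuousOn_rpow_Icc {a b : ℝ} (ha : 0 < a) (v : ℝ) :
    ContinuousOn (fun r : ℝ => r ^ v) (Set.Icc a b) :=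
  continuousOn_id.rpow_const fun _ hr => Or.inl (ha.trans_le hr.1).ne'

theorem continuousOn_logPrimitive {a b : ℝ} (ha : 0 < a) (v : ℝ) :
    ContinuousOn (fun r : ℝ => logPrimitive r v) (Set.Icc a b) := by
  unfold logPrimitive
  split_ifs
  · exact continuousOn_id.log fun r hr => (ha.trans_le hr.1).ne'
  · exact ((continuousOn_rpow_Icc ha v).sub continuousOn_const).div_const v

theorem memLp_of_mem_rmnDirectClass {d K : ℕ} {a b : ℝ} (ha : 0 < a) {E : Set (Fin K → ℝ)}
    {φ : EuclideanSpace ℝ (Fin d) → ℝ} (hφ : φ ∈ rmnDirectClass d K E) :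
    MemLp φ 2 (annulusMeasure d a b) := by
  obtain ⟨μ, -, coef, c₀, v, b₀, rfl⟩ := hφ
  refine memLp_radial (k := fun r => (∑ k, coef k * r ^ μ k) + c₀ * logPrimitive r v + b₀) ?_
  exact ((continuousOn_finsetSum _ fun k _ =>
    continuousOn_const.mul (continuousOn_rpow_Icc ha (μ k))).add
    (continuousOn_const.mul (continuousOn_logPrimitive ha v))).add continuousOn_const

theorem rmnDirectPowerClass_subset (d K : ℕ) (E : Set (Fin K → ℝ)) :
    rmnDirectPowerClass d K E ⊆ rmnDirectClass d K E := by
  rintro _ ⟨μ, hμ, coef, b₀, rfl⟩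
  exact ⟨μ, hμ, coef, 0, 0, b₀, by ext x; simp [rmnDirect]⟩

theorem sum_rpow_mem_rmnDirectPowerClass {d : ℕ} {E : (K : ℕ) → Set (Fin K → ℝ)} {μ : ℕ → ℝ}
    (hE : RealizesInLimit E μ) (N : ℕ) (c : ℕ → ℝ) (b₀ : ℝ) :
    (fun x : EuclideanSpace ℝ (Fin d) => (∑ k ∈ Finset.range N, c k * ‖x‖ ^ μ k) + b₀)
      ∈ ⋃ K, rmnDirectPowerClass d K (E K) := by
  obtain ⟨K, ν, hν, hex⟩ := hE N
  have : ∀ k : Fin N, ∃ j : Fin K, ν j = μ k := fun k => hex k k.2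
  choose j hj using this
  -- Summing over the fibre of `j` handles coinciding indices, and entries outside its range get
  -- coefficient 0.
  refine Set.mem_iUnion.2 ⟨K, ν, hν, fun i => ∑ k : Fin N, if j k = i then c k else 0, b₀, ?_⟩
  ext x
  congr 1
  simp_rw [Finset.sum_mul, ite_mul, zero_mul]
  rw [Finset.sum_comm, Finset.sum_range]
  exact Finset.sum_congr rfl fun k _ => by simp [hj]

/-- Every radial square integrable function on the annulus is approximated in `L²` by continuous
radial functions. -/
theorem exists_continuous_radial_near {d : ℕ} (hd : 1 ≤ d) {a b : ℝ} (f : radialL2 d a b)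
    {ε : ENNReal} (hε : ε ≠ 0) :
    ∃ g : ℝ → ℝ, Continuous g ∧
      eLpNorm (fun x => (f : Lp ℝ 2 (annulusMeasure d a b)) x - g ‖x‖) 2
        (annulusMeasure d a b) ≤ ε := by
  obtain ⟨f, h, hf⟩ := f
  have : Nonempty (Fin d) := ⟨⟨0, hd⟩⟩
  obtain ⟨k, hk, hfk⟩ := exists_measurable_radial_ae_eq
    (volume : Measure (EuclideanSpace ℝ (Fin d))) (measurableSet_Icc (a := a) (b := b))
    (Lp.stronglyMeasurable f).measurable hf
  have hmp : AEMeasurable (fun x : EuclideanSpace ℝ (Fin d) => ‖x‖) (annulusMeasure d a b) :=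
    measurable_norm.aemeasurable
  have hkL : MemLp k 2 ((annulusMeasure d a b).map (‖·‖)) := by
    rw [memLp_map_measure_iff hk.aestronglyMeasurable hmp]
    exact (memLp_congr_ae hfk).1 (Lp.memLp f)
  obtain ⟨g, hg, -⟩ := hkL.exists_boundedContinuous_eLpNorm_sub_le (by simp) hε
  refine ⟨g, g.continuous, ?_⟩
  rw [eLpNorm_map_measure (hk.sub g.continuous.measurable).aestronglyMeasurable hmp] at hg
  refine le_of_eq_of_le (eLpNorm_congr_ae ?_) hg
  filter_upwards [hfk] with x hx
  simp only [Function.comp_apply, Pi.sub_apply]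
  rw [← hx]

theorem dense_inRadialL2_powerClass {d : ℕ} (hd : 1 ≤ d) {a b : ℝ} (ha : 0 < a) (hab : a < b)
    {E : (K : ℕ) → Set (Fin K → ℝ)} {μ : ℕ → ℝ} (hμ : IsBilateralMuntzSequence μ)
    (hE : RealizesInLimit E μ) :
    Dense (inRadialL2 d a b (⋃ K, rmnDirectPowerClass d K (E K))) := by
  obtain ⟨hinj, p, _, hp, -, -, -, hM⟩ := hμ
  intro f
  refine EMetric.mem_closure_iff.2 fun ε hε => ?_
  obtain ⟨g, hg, hfg⟩ := exists_continuous_radial_near hd f (ENNReal.half_pos hε.ne').ne'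
  set m := annulusMeasure d a b
  -- A uniform error `δ` costs at most `δ` times this factor in `L²`.
  have hmass : m Set.univ ^ (2 : ENNReal).toReal⁻¹ ≠ ⊤ :=
    ENNReal.rpow_ne_top_of_nonneg (by simp) (measure_ne_top m _)
  obtain ⟨δ, hδ, hδε⟩ := ENNReal.exists_nnreal_pos_mul_lt hmass (ENNReal.half_pos hε.ne').ne'
  obtain ⟨N, c, b₀, hc⟩ := exists_sum_rpow_near ha hab.le hinj hp.injective hM.tendsto_pos
    hM.diverges_pos ⟨fun r => g r, hg.comp continuous_subtype_val⟩ (NNReal.coe_pos.2 hδ)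
  let u : ℝ → ℝ := fun r => (∑ k ∈ Finset.range N, c k * r ^ μ k) + b₀
  have hu : MemLp (fun x => u ‖x‖) 2 m := memLp_radial <|
    (continuousOn_finsetSum _ fun k _ =>
      continuousOn_const.mul (continuousOn_rpow_Icc ha (μ k))).add continuousOn_const
  have hgu : eLpNorm (fun x => g ‖x‖ - u ‖x‖) 2 m < ε / 2 := by
    refine (eLpNorm_le_of_ae_bound (C := δ) ?_).trans_lt ?_
    · filter_upwards [ae_mem_annulus d a b] with x hx using (hc ⟨‖x‖, hx⟩).le
    · rwa [ENNReal.ofReal_coe_nnreal, mul_comm]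
  refine ⟨⟨hu.toLp _, u, hu.coeFn_toLp⟩,
    ⟨_, sum_rpow_mem_rmnDirectPowerClass hE N c b₀, hu.coeFn_toLp⟩, ?_⟩
  have hgm : MemLp (fun x => g ‖x‖) 2 m := memLp_radial hg.continuousOn
  calc edist f ⟨hu.toLp _, u, hu.coeFn_toLp⟩
      = eLpNorm (fun x => (f : Lp ℝ 2 m) x - u ‖x‖) 2 m := by
        rw [Subtype.edist_eq, Lp.edist_def]
        refine eLpNorm_congr_ae ?_
        filter_upwards [hu.coeFn_toLp] with x hx
        rw [Pi.sub_apply, hx]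
    _ = eLpNorm ((fun x => (f : Lp ℝ 2 m) x - g ‖x‖) + fun x => g ‖x‖ - u ‖x‖) 2 m := by
        congr 1
        ext x
        simp
    _ ≤ eLpNorm (fun x => (f : Lp ℝ 2 m) x - g ‖x‖) 2 m
          + eLpNorm (fun x => g ‖x‖ - u ‖x‖) 2 m :=
        eLpNorm_add_le ((Lp.memLp (f : Lp ℝ 2 m)).sub hgm).aestronglyMeasurable
          (hgm.sub hu).aestronglyMeasurable (by simp)
    _ < ε / 2 + ε / 2 := ENNReal.add_lt_add_of_le_of_lt
        ((Lp.memLp (f : Lp ℝ 2 m)).sub hgm).eLpNorm_lt_top.ne hfg hgu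
    _ = ε := ENNReal.add_halves ε

theorem mainTheorem3 (d : ℕ) (hd : 1 ≤ d) (a b : ℝ) (ha : 0 < a) (hab : a < b)
    (E : (K : ℕ) → Set (Fin K → ℝ))
    (hE : ∃ μ : ℕ → ℝ, IsBilateralMuntzSequence μ ∧ RealizesInLimit E μ) :
    (∀ φ ∈ ⋃ K, rmnDirectClass d K (E K), MemLp φ 2 (annulusMeasure d a b)) ∧
    Dense (inRadialL2 d a b (⋃ K, rmnDirectPowerClass d K (E K))) ∧
    Dense (inRadialL2 d a b (⋃ K, rmnDirectClass d K (E K))) := by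
  obtain ⟨μ, hμ, hreal⟩ := hE
  have hdense := dense_inRadialL2_powerClass hd ha hab hμ hreal
  refine ⟨fun φ hφ => ?_, hdense, hdense.mono ?_⟩
  · obtain ⟨K, hK⟩ := Set.mem_iUnion.1 hφ
    exact memLp_of_mem_rmnDirectClass ha hK
  · rintro g ⟨φ, hφ, hg⟩
    exact ⟨φ, Set.iUnion_mono (fun K => rmnDirectPowerClass_subset d K (E K)) hφ, hg⟩
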